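/- Let $I\subseteq(1,\infty)$ be open, let $\theta_0,\theta_1,\theta_t$ be real constants, and for $t\in I$ and $\nu\in\{0,1,t\}$ let $z_\nu=z_\nu(t)$ and $u_\nu=u_\nu(t)\neq0$ be real; put $$W_\nu=W_\nu(t)=\begin{pmatrix} z_\nu+\theta_\nu/2 & -u_\nu z_\nu\\ u_\nu^{-1}(z_\nu+\theta_\nu) & -z_\nu-\theta_\nu/2\end{pmatrix},\qquad J=\begin{pmatrix}0&-1\\1&0\end{pmatrix},\qquad \sigma_{j,k}=\begin{pmatrix} I_j&0\\0&-I_k\end{pmatrix}.$$ Suppose that $W_\infty=-(W_0+W_1+W_t)$ has eigenvalues $\mp\theta_\infty/2$ for all $t\in I$, where $\theta_\infty$ is a constant such that neither $\theta_\infty$ nor $-\theta_\infty$ is a positive integer. For each $t\in I$ let $\Phi(\cdot\,;t):(t,\infty)\to\mathbb R^2$ be a bounded solution of the Fuchsian system $$\frac{d\Phi}{d\lambda}=\Bigl(\frac{W_0}{\lambda}+\frac{W_1}{\lambda-1}+\frac{W_t}{\lambda-t}\Bigr)\Phi\qquad(\lambda>t)\tag{1}$$ such that $\int_t^\infty\lambda^{-1}\|\Phi(\lambda;t)\|^2\,d\lambda<\infty$,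 and let $$K(\lambda,\mu;t)=\frac{\langle J\Phi(\lambda;t),\Phi(\mu;t)\rangle}{\lambda-\mu}\qquad(\lambda,\mu>t,\ \lambda\neq\mu).$$ (i) For each $t\in I$ there exist real $2\times2$ matrices $V_0,V_1,V_t$ with $JW_\nu=V_\nu^{\top}\sigma_{1,1}V_\nu$ such that the function $\phi:(t,\infty)\to\mathbb R^6=\mathbb R^3\oplus\mathbb R^3$, whose first three coordinates are the first coordinates, and whose last three coordinates are the second coordinates, of the vectors $V_\nu\Phi(\lambda;t)/(\lambda-\nu)$ $(\nu=0,1,t)$, has the following properties. The function $x\mapsto\phi(t+x)$ belongs to $L^2((0,\infty);x\,dx;\mathbb R^6)$, that is, $\int_t^\infty(\lambda-t)\|\phi(\lambda)\|^2\,d\lambda<\infty$, and $$K(\lambda,\mu;t)=\int_0^\infty\langle\sigma_{3,3}\,\phi(\lambda+s),\phi(\mu+s)\rangle\,ds\qquad(\lambda,\mu>t,\ \lambda\neq\mu),$$ the integral being absolutely convergent. The formula $\Gamma_\phi h(s)=\int_t^\infty\phi(s+\lambda)h(\lambda)\,d\lambda$ defines a bounded operator $\Gamma_\phi:L^2((t,\infty);\mathbb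 C)\to L^2((0,\infty);\mathbb C^6)$, and the integral operator $K$ on $L^2((t,\infty);\mathbb C)$ with kernel $K(\lambda,\mu;t)$ is bounded, satisfies $K=\Gamma_\phi^\dagger\sigma_{3,3}\Gamma_\phi$, and is trace class. (ii) Suppose that $\Phi$ moreover satisfies the deformation equation $$\frac{\partial\Phi}{\partial t}=-\frac{W_t}{\lambda-t}\Phi\qquad(t\in I,\ \lambda>t).\tag{2}$$ Then for each $t\in I$ the derivative $\frac{\partial}{\partial t}K(\lambda,\mu;t)$ exists for all $\lambda,\mu>t$ with $\lambda\neq\mu$, and it is of finite rank in $(\lambda,\mu)$: it is a finite sum of products $a_i(\lambda)b_i(\mu)$ with $a_i,b_i$ continuous on $(t,\infty)$. (The system (1), (2) is the one whose compatibility condition gives Painlevé VI; no compatibility is assumed.) -/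

import Mathlib

open MeasureTheory Set Matrix
open scoped InnerProductSpace

noncomputable section

namespace PainleveSix

/-- The Euclidean plane in which the solutions of the linear system take their values. -/
abbrev Plane : Type := EuclideanSpace ℝ (Fin 2)

/-- The singular points `0, 1, t` in the finite plane. -/
def pole (t : ℝ) : Fin 3 → ℝ := ![0, 1, t]

/-- The residue matrix with parameters `z, θ, u`. -/
def residue (z θ u : ℝ) : Matrix (Fin 2) (Fin 2) ℝ :=
  !![z + θ / 2, -(u * z); u⁻¹ * (z + θ), -z - θ / 2]

/-- The residue matrices `W₀(t), W₁(t), W_t(t)` at the poles `0, 1, t`. -/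
def W (θ : Fin 3 → ℝ) (z u : Fin 3 → ℝ → ℝ) (t : ℝ) (ν : Fin 3) : Matrix (Fin 2) (Fin 2) ℝ :=
  residue (z ν t) (θ ν) (u ν t)

/-- The residue matrix at infinity, `W_∞ = -(W₀ + W₁ + W_t)`. -/
def WInf (θ : Fin 3 → ℝ) (z u : Fin 3 → ℝ → ℝ) (t : ℝ) : Matrix (Fin 2) (Fin 2) ℝ :=
  -∑ ν, W θ z u t ν

/-- The coefficient `W₀/x + W₁/(x - 1) + W_t/(x - t)` of the linear system in `x`. -/
def coeff (θ : Fin 3 → ℝ) (z u : Fin 3 → ℝ → ℝ) (t x : ℝ) : Matrix (Fin 2) (Fin 2) ℝ :=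
  ∑ ν, (x - pole t ν)⁻¹ • W θ z u t ν

/-- The rotation matrix `J`. -/
def J : Matrix (Fin 2) (Fin 2) ℝ := !![0, -1; 1, 0]

/-- The kernel `⟨J Ψ(x), Ψ(y)⟩ / (x - y)`. -/
def kernel (Ψ : ℝ → Plane) (x y : ℝ) : ℝ :=
  ⟪toEuclideanLin J (Ψ x), Ψ y⟫_ℝ / (x - y)

/-- The signature matrix with diagonal blocks `I_j` and `-I_k`. -/
def sig (R : Type*) [Ring R] (j k : ℕ) : Matrix (Fin j ⊕ Fin k) (Fin j ⊕ Fin k) R :=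
  fromBlocks 1 0 0 (-1)

/-- Six dimensional Euclidean space over `𝕜`, with its coordinates split as `3 + 3`. -/
abbrev Six (𝕜 : Type) : Type := EuclideanSpace 𝕜 (Fin 3 ⊕ Fin 3)

/-- The six functions `V_ν Ψ(x) / (x - ν)` for `ν = 0, 1, t`; the first coordinates of the three
vectors come first and the second coordinates come last. -/
def symbol (t : ℝ) (V : Fin 3 → Matrix (Fin 1 ⊕ Fin 1) (Fin 2) ℝ) (Ψ : ℝ → Plane) (x : ℝ) :
    Six ℝ :=
  WithLp.toLp 2 (Sum.elim
    (fun ν => (V ν *ᵥ (Ψ x).ofLp) (Sum.inl 0) / (x - pole t ν))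
    (fun ν => (V ν *ᵥ (Ψ x).ofLp) (Sum.inr 0) / (x - pole t ν)))

/-- A vector of `ℝ⁶` as a vector of `ℂ⁶`. -/
def complexify (v : Six ℝ) : Six ℂ := WithLp.toLp 2 (fun i => (v.ofLp i : ℂ))

/-- The measure `x dx` on `(0, ∞)`. -/
def weightedHalfLine : Measure ℝ :=
  (volume.restrict (Ioi (0 : ℝ))).withDensity (fun x => ENNReal.ofReal x)

/-- The complex Hilbert space `L²((a, ∞); dx; F)`. -/
abbrev L2 (a : ℝ) (F : Type) [NormedAddCommGroup F] : Type :=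
  Lp F 2 (volume.restrict (Ioi a))

/-- The bounded operator `T : L²(a, ∞) → L²((b, ∞); F)` is the integral operator with kernel `k`:
`(T f)(x) = ∫_a^∞ k(x, y) f(y) dy` for almost every `x > b`, the integral being convergent. -/
def IsIntegralOperator {a b : ℝ} {F : Type} [NormedAddCommGroup F] [NormedSpace ℂ F]
    (T : L2 a ℂ →L[ℂ] L2 b F) (k : ℝ → ℝ → F) : Prop :=
  ∀ f : L2 a ℂ, ∀ᵐ x ∂(volume.restrict (Ioi b)),
    IntegrableOn (fun y => f y • k x y) (Ioi a) ∧ T f x = ∫ y in Ioi a, f y • k x y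

/-- Pointwise application of the signature matrix `σ_{3,3}` on `L²((b, ∞); ℂ⁶)`. -/
def sigOp (b : ℝ) : L2 b (Six ℂ) →L[ℂ] L2 b (Six ℂ) :=
  (toEuclideanCLM (𝕜 := ℂ) (sig ℂ 3 3)).compLpL 2 (volume.restrict (Ioi b))

/-- Trace class (nuclear) operators on a Hilbert space: `T = ∑ ⟨pₙ, ·⟩ qₙ` with
`∑ ‖pₙ‖ ‖qₙ‖ < ∞`. -/
def IsTraceClass {H : Type*} [NormedAddCommGroup H] [InnerProductSpace ℂ H] (T : H →L[ℂ] H) :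
    Prop :=
  ∃ p q : ℕ → H, Summable (fun n => ‖p n‖ * ‖q n‖) ∧
    ∀ f, HasSum (fun n => ⟪p n, f⟫_ℂ • q n) (T f)

/-- On `(t, ∞)`, off the diagonal, `k` is a finite sum of products of a continuous function of `x`
and a continuous function of `y`. -/
def IsFiniteRankKernel (t : ℝ) (k : ℝ → ℝ → ℝ) : Prop :=
  ∃ (n : ℕ) (a b : Fin n → ℝ → ℝ),
    (∀ i, ContinuousOn (a i) (Ioi t)) ∧ (∀ i, ContinuousOn (b i) (Ioi t)) ∧
    ∀ x > t, ∀ y > t, x ≠ y → k x y = ∑ i, a i x * b i y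

end PainleveSix

end

/-!
Write `φ` for the symbol and `σ` for the signature matrix. Since the residues `W_ν` are traceless,
`J W_ν` is symmetric, and `det (J W_ν) = -θ_ν² / 4 ≤ 0` makes its quadratic form a difference of two
squares, `J W_ν = V_νᵀ σ V_ν` (`exists_signature_factorization`). Differentiating the kernel along
`(x + s, y + s)` with the differential equation then gives exactly `-⟪σ φ(x + s), φ(y + s)⟫`
(`hasDerivAt_kernel_add`). The kernel tends to `0` along this line because `⟪J v, v⟫ = 0` and
`Ψ(x + s) - Ψ(y + s) = O(1 / s)` for a bounded solution (`tendsto_kernel_add_atTop`), and the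
integral formula follows.

The analytic point is `∫ (x - t) ‖φ(x)‖² dx < ∞`
(`integrableOn_weight_mul_norm_symbol_sq`). At infinity this is the hypothesis on `‖Ψ‖² / x`. At
`x = t` it requires `∫ ‖V_t Ψ‖² / (x - t) < ∞`, although `Ψ` is only known to be bounded. There
`W_t² = θ_t² / 4`, so the bounded function `⟪W_t Ψ, Ψ⟫` has derivative
`(‖W_t Ψ‖² + (θ_t² / 4) ‖Ψ‖²) / (x - t)` up to a bounded term, and this positive quantity is
integrable (`integrableOn_Ioc_of_energy_estimate`). It controls `‖V_t Ψ‖² / (x - t)` provided that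
`V_t` vanishes on `ker W_t` when `θ_t = 0`, which can be arranged.

The weighted bound says that the Hankel kernel `φ(s + x)` is square integrable
(`memLp_two_hankel`). Hence `Γ` is a Hilbert–Schmidt operator, and `K = Γ† σ Γ` is trace class, being
the sum of the rank one operators `⟪Γ† eₙ, ·⟫ Γ† σ eₙ` for an orthonormal basis `eₙ`
(`isTraceClass_adjoint_comp_hilbertSchmidtOp`).

Under the deformation equation the same partial fraction identity, with the pole `t` alone, gives
`∂K/∂t = ⟪J W_t Φ(x), Φ(y)⟫ / ((x - t) (y - t))`, a kernel of rank at most two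
(`hasDerivAt_kernel_param`).
-/

noncomputable section

namespace PainleveSix

set_option linter.unusedSectionVars false

/-! ### Integral operators with square integrable kernels -/

section KernelOperator

variable {α β E F G : Type*} [MeasurableSpace α] [MeasurableSpace β]
  {μ : Measure α} {ν : Measure β} [SFinite μ] [SFinite ν]
  [NormedAddCommGroup G]
  [NormedAddCommGroup E] [InnerProductSpace ℂ E] [CompleteSpace E]
  [NormedAddCommGroup F] [InnerProductSpace ℂ F] [CompleteSpace F]

theorem ae_memLp_two_slice {k : α → β → G}
    (hk : MemLp (Function.uncurry k) 2 (μ.prod ν)) : ∀ᵐ s ∂μ, MemLp (k s) 2 ν := by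
  filter_upwards [hk.1.prodMk_left, ((memLp_two_iff_integrable_sq_norm hk.1).1 hk).prod_right_ae]
    with s h1 h2
  exact (memLp_two_iff_integrable_sq_norm h1).2 h2

theorem memLp_two_swap {k : α → β → G} (hk : MemLp (Function.uncurry k) 2 (μ.prod ν)) :
    MemLp (Function.uncurry fun y s => k s y) 2 (ν.prod μ) :=
  hk.comp_measurePreserving Measure.measurePreserving_swap

theorem memLp_two_mul_prod {f : α → ℝ} {g : β → ℝ} (hf : MemLp f 2 μ) (hg : MemLp g 2 ν) :
    MemLp (fun p : α × β => f p.1 * g p.2) 2 (μ.prod ν) := by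
  have hm : AEStronglyMeasurable (fun p : α × β => f p.1 * g p.2) (μ.prod ν) :=
    hf.1.comp_fst.mul hg.1.comp_snd
  rw [memLp_two_iff_integrable_sq hm]
  simp only [mul_pow]
  exact hf.integrable_sq.mul_prod hg.integrable_sq

theorem L2_norm_sq_eq_integral {f : β → E} (hf : MemLp f 2 ν) :
    ‖hf.toLp f‖ ^ 2 = ∫ y, ‖f y‖ ^ 2 ∂ν := by
  rw [← inner_self_eq_norm_sq (𝕜 := ℂ), L2.inner_def, ← integral_re (L2.integrable_inner _ _)]
  refine integral_congr_ae ?_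
  filter_upwards [hf.coeFn_toLp] with y hy
  rw [hy, inner_self_eq_norm_sq]

theorem L2_norm_sq_eq_integral_coe (f : Lp E 2 ν) : ‖f‖ ^ 2 = ∫ y, ‖f y‖ ^ 2 ∂ν := by
  conv_lhs => rw [← Lp.toLp_coeFn f (Lp.memLp f)]
  exact L2_norm_sq_eq_integral _

/-- The Cauchy–Schwarz inequality for the integral of an operator valued function against a vector
valued one. -/
theorem norm_integral_apply_sq_le {A : β → E →L[ℂ] F} {f : β → E} (hA : MemLp A 2 ν)
    (hf : MemLp f 2 ν) :
    ‖∫ y, A y (f y) ∂ν‖ ^ 2 ≤ (∫ y, ‖A y‖ ^ 2 ∂ν) * ∫ y, ‖f y‖ ^ 2 ∂ν := by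
  have h1 : ‖∫ y, A y (f y) ∂ν‖ ≤ ∫ y, ‖A y‖ * ‖f y‖ ∂ν :=
    norm_integral_le_of_norm_le (hA.norm.integrable_mul hf.norm)
      (Filter.Eventually.of_forall fun y => (A y).le_opNorm (f y))
  have h2 : ∫ y, ‖A y‖ * ‖f y‖ ∂ν ≤
      √(∫ y, ‖A y‖ ^ 2 ∂ν) * √(∫ y, ‖f y‖ ^ 2 ∂ν) := by
    have := integral_mul_norm_le_Lp_mul_Lq (μ := ν) (f := fun y => ‖A y‖)
      (g := fun y => ‖f y‖) (p := 2) (q := 2)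
      Real.HolderConjugate.two_two (by simpa using hA.norm) (by simpa using hf.norm)
    simpa [Real.sqrt_eq_rpow] using this
  calc _ ≤ (√(∫ y, ‖A y‖ ^ 2 ∂ν) * √(∫ y, ‖f y‖ ^ 2 ∂ν)) ^ 2 := by
        gcongr; exact h1.trans h2
    _ = _ := by
        rw [mul_pow, Real.sq_sqrt (integral_nonneg fun _ => sq_nonneg _),
          Real.sq_sqrt (integral_nonneg fun _ => sq_nonneg _)]

theorem integrable_kernel_apply {A : β → E →L[ℂ] F} {f : β → E} (hA : MemLp A 2 ν)
    (hf : MemLp f 2 ν) : Integrable (fun y => A y (f y)) ν :=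
  (hA.norm.integrable_mul hf.norm).mono'
    ((ContinuousLinearMap.id ℂ (E →L[ℂ] F)).aestronglyMeasurable_comp₂ hA.1 hf.1)
    (Filter.Eventually.of_forall fun y => (A y).le_opNorm (f y))

theorem aestronglyMeasurable_kernel_apply {A : α → β → E →L[ℂ] F}
    (hA : MemLp (Function.uncurry A) 2 (μ.prod ν)) {f : β → E} (hf : MemLp f 2 ν) :
    AEStronglyMeasurable (fun p : α × β => A p.1 p.2 (f p.2)) (μ.prod ν) :=
  (ContinuousLinearMap.id ℂ (E →L[ℂ] F)).aestronglyMeasurable_comp₂ hA.1 hf.1.comp_snd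

theorem memLp_two_kernel_integral {A : α → β → E →L[ℂ] F}
    (hA : MemLp (Function.uncurry A) 2 (μ.prod ν)) {f : β → E} (hf : MemLp f 2 ν) :
    MemLp (fun s => ∫ y, A s y (f y) ∂ν) 2 μ := by
  have hm := (aestronglyMeasurable_kernel_apply hA hf).integral_prod_right'
  rw [memLp_two_iff_integrable_sq_norm hm]
  refine Integrable.mono' (((memLp_two_iff_integrable_sq_norm hA.1).1 hA).integral_prod_left.mul_const
    (∫ y, ‖f y‖ ^ 2 ∂ν)) (hm.norm.pow 2) ?_
  filter_upwards [ae_memLp_two_slice hA] with s hs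
  simpa using norm_integral_apply_sq_le hs hf

/-- The integral operator `f ↦ ∫ A(·, y) f(y) dy` between `L²` spaces whose operator valued kernel
is square integrable. -/
def kernelOp (A : α → β → E →L[ℂ] F) (hA : MemLp (Function.uncurry A) 2 (μ.prod ν)) :
    Lp E 2 ν →L[ℂ] Lp F 2 μ :=
  LinearMap.mkContinuous
    { toFun := fun f => (memLp_two_kernel_integral hA (Lp.memLp f)).toLp _
      map_add' := fun f g => by
        rw [← MemLp.toLp_add, MemLp.toLp_eq_toLp_iff]
        filter_upwards [ae_memLp_two_slice hA] with s hs
        simp only [Pi.add_apply]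
        have hint : ∀ f : Lp E 2 ν, Integrable (fun y => A s y (f y)) ν := fun f =>
          integrable_kernel_apply hs (Lp.memLp f)
        rw [← integral_add (hint f) (hint g)]
        refine integral_congr_ae ?_
        filter_upwards [Lp.coeFn_add f g] with y hy
        rw [hy, Pi.add_apply, map_add]
      map_smul' := fun c f => by
        rw [RingHom.id_apply, ← MemLp.toLp_const_smul, MemLp.toLp_eq_toLp_iff]
        refine Filter.Eventually.of_forall fun s => ?_
        simp only [Pi.smul_apply]
        rw [← integral_smul]
        refine integral_congr_ae ?_
        filter_upwards [Lp.coeFn_smul c f] with y hy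
        rw [hy, Pi.smul_apply, map_smul] }
    √(∫ p, ‖Function.uncurry A p‖ ^ 2 ∂μ.prod ν) fun f => by
      have hi := (memLp_two_iff_integrable_sq_norm hA.1).1 hA
      refine abs_le_of_sq_le_sq' ?_ (by positivity) |>.2
      rw [mul_pow, Real.sq_sqrt (integral_nonneg fun _ => sq_nonneg _), LinearMap.coe_mk,
        AddHom.coe_mk, L2_norm_sq_eq_integral, L2_norm_sq_eq_integral_coe f, integral_prod _ hi,
        ← integral_mul_const]
      refine integral_mono_ae ((memLp_two_iff_integrable_sq_norm
        (memLp_two_kernel_integral hA (Lp.memLp f)).1).1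
          (memLp_two_kernel_integral hA (Lp.memLp f))) (hi.integral_prod_left.mul_const _) ?_
      filter_upwards [ae_memLp_two_slice hA] with s hs
      exact norm_integral_apply_sq_le hs (Lp.memLp f)

theorem kernelOp_apply_ae (A : α → β → E →L[ℂ] F)
    (hA : MemLp (Function.uncurry A) 2 (μ.prod ν)) (f : Lp E 2 ν) :
    ∀ᵐ s ∂μ, kernelOp A hA f s = ∫ y, A s y (f y) ∂ν :=
  (memLp_two_kernel_integral hA (Lp.memLp f)).coeFn_toLp

theorem integrable_inner_kernel_apply {A : α → β → E →L[ℂ] F}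
    (hA : MemLp (Function.uncurry A) 2 (μ.prod ν)) {f : β → E} (hf : MemLp f 2 ν)
    {h : α → F} (hh : MemLp h 2 μ) :
    Integrable (fun p : α × β => ⟪h p.1, A p.1 p.2 (f p.2)⟫_ℂ) (μ.prod ν) := by
  refine (hA.norm.integrable_mul (memLp_two_mul_prod hh.norm hf.norm)).mono'
    (hh.1.comp_fst.inner (aestronglyMeasurable_kernel_apply hA hf))
    (Filter.Eventually.of_forall fun p => ?_)
  refine (norm_inner_le_norm _ _).trans ?_
  calc _ ≤ ‖h p.1‖ * (‖A p.1 p.2‖ * ‖f p.2‖) := by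
        gcongr; exact (A p.1 p.2).le_opNorm (f p.2)
    _ = _ := by simp [Function.uncurry]; ring

theorem memLp_two_adjoint_kernel {A : α → β → E →L[ℂ] F}
    (hA : MemLp (Function.uncurry A) 2 (μ.prod ν)) :
    MemLp (Function.uncurry fun y s => ContinuousLinearMap.adjoint (A s y)) 2 (ν.prod μ) :=
  (memLp_two_swap hA).of_le
    (ContinuousLinearMap.adjoint.continuous.comp_aestronglyMeasurable (memLp_two_swap hA).1)
    (Filter.Eventually.of_forall fun p => by simp [Function.uncurry])

/-- The adjoint of an integral operator is the integral operator with the adjoint kernel. -/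
theorem adjoint_kernelOp (A : α → β → E →L[ℂ] F)
    (hA : MemLp (Function.uncurry A) 2 (μ.prod ν)) :
    ContinuousLinearMap.adjoint (kernelOp A hA) =
      kernelOp (fun y s => ContinuousLinearMap.adjoint (A s y)) (memLp_two_adjoint_kernel hA) := by
  symm
  rw [ContinuousLinearMap.eq_adjoint_iff]
  intro h f
  have hI := integrable_inner_kernel_apply hA (Lp.memLp f) (Lp.memLp h)
  have hs := ae_memLp_two_slice hA
  have hy := ae_memLp_two_slice (memLp_two_adjoint_kernel hA)
  calc _ = ∫ y, ∫ s, ⟪h s, A s y (f y)⟫_ℂ ∂μ ∂ν := by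
        rw [L2.inner_def]
        refine integral_congr_ae ?_
        filter_upwards [hy, kernelOp_apply_ae _ (memLp_two_adjoint_kernel hA) h] with y hy1 hy2
        rw [hy2, ← inner_conj_symm,
          ← integral_inner (integrable_kernel_apply hy1 (Lp.memLp h)), ← integral_conj]
        simp [inner_conj_symm, ContinuousLinearMap.adjoint_inner_left]
    _ = ∫ s, ∫ y, ⟪h s, A s y (f y)⟫_ℂ ∂ν ∂μ := (integral_integral_swap hI).symm
    _ = _ := by
        rw [L2.inner_def]
        refine integral_congr_ae ?_
        filter_upwards [hs, kernelOp_apply_ae A hA f] with s hs1 hs2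
        rw [hs2, ← integral_inner (integrable_kernel_apply hs1 (Lp.memLp f))]

end KernelOperator

/-! ### Hilbert–Schmidt and trace class operators -/

/-- Nuclear expansions may be indexed by an arbitrary type: summability leaves only countably many
nonzero terms. -/
theorem isTraceClass_of_hasSum {ι H : Type*} [NormedAddCommGroup H] [InnerProductSpace ℂ H]
    {T : H →L[ℂ] H} (p q : ι → H) (hpq : Summable fun i => ‖p i‖ * ‖q i‖)
    (hT : ∀ f, HasSum (fun i => ⟪p i, f⟫_ℂ • q i) (T f)) : IsTraceClass T := by
  set S : Set ι := Function.support fun i => ‖p i‖ * ‖q i‖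
  have hS : S.Countable := hpq.countable_support
  have : Countable S := hS.to_subtype
  obtain ⟨e, he⟩ := exists_injective_nat S
  refine ⟨Function.extend e (fun i => p i) 0, Function.extend e (fun i => q i) 0, ?_, fun f => ?_⟩
  · rw [← he.summable_iff]
    · refine (hpq.comp_injective Subtype.val_injective).congr fun i => ?_
      simp [he.extend_apply]
    · intro n hn
      rw [Function.extend_apply' _ _ _ (by simpa using hn)]
      simp
  · rw [← he.hasSum_iff]
    · have h1 : HasSum (fun i : S => ⟪p i, f⟫_ℂ • q i) (T f) := by
        refine (hasSum_subtype_iff_of_support_subset (f := fun i => ⟪p i, f⟫_ℂ • q i) ?_).2 (hT f)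
        intro i hi
        have h2 : p i ≠ 0 := by rintro h; simp [h] at hi
        have h3 : q i ≠ 0 := by rintro h; simp [h] at hi
        simp [S, h2, h3]
      convert h1 using 2 with i
      simp [he.extend_apply]
    · intro n hn
      rw [Function.extend_apply' _ _ _ (by simpa using hn)]
      simp

section HilbertSchmidt

variable {α β F : Type*} [MeasurableSpace α] [MeasurableSpace β]
  {μ : Measure α} {ν : Measure β} [SFinite μ] [SFinite ν]
  [NormedAddCommGroup F] [InnerProductSpace ℂ F] [CompleteSpace F]

theorem memLp_two_toSpanSingleton {k : α → β → F}
    (hk : MemLp (Function.uncurry k) 2 (μ.prod ν)) :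
    MemLp (Function.uncurry fun s y => ContinuousLinearMap.toSpanSingleton ℂ (k s y)) 2
      (μ.prod ν) :=
  hk.of_le ((ContinuousLinearMap.toSpanSingletonLIE ℂ F).continuous.comp_aestronglyMeasurable hk.1)
    (Filter.Eventually.of_forall fun p => by simp [Function.uncurry])

/-- The integral operator from scalar functions to vector valued functions with the square
integrable vector valued kernel `k`. -/
def hilbertSchmidtOp (k : α → β → F) (hk : MemLp (Function.uncurry k) 2 (μ.prod ν)) :
    Lp ℂ 2 ν →L[ℂ] Lp F 2 μ :=
  kernelOp _ (memLp_two_toSpanSingleton hk)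

theorem hilbertSchmidtOp_apply_ae (k : α → β → F)
    (hk : MemLp (Function.uncurry k) 2 (μ.prod ν)) (f : Lp ℂ 2 ν) :
    ∀ᵐ s ∂μ, Integrable (fun y => f y • k s y) ν ∧
      hilbertSchmidtOp k hk f s = ∫ y, f y • k s y ∂ν := by
  filter_upwards [kernelOp_apply_ae _ (memLp_two_toSpanSingleton hk) f,
    ae_memLp_two_slice (memLp_two_toSpanSingleton hk)] with s h1 h2
  exact ⟨by simpa using integrable_kernel_apply h2 (Lp.memLp f),
    by simpa [hilbertSchmidtOp] using h1⟩

theorem adjoint_hilbertSchmidtOp_apply_ae (k : α → β → F)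
    (hk : MemLp (Function.uncurry k) 2 (μ.prod ν)) (h : Lp F 2 μ) :
    ∀ᵐ y ∂ν, ContinuousLinearMap.adjoint (hilbertSchmidtOp k hk) h y =
      ∫ s, ⟪k s y, h s⟫_ℂ ∂μ := by
  rw [hilbertSchmidtOp, adjoint_kernelOp]
  filter_upwards [kernelOp_apply_ae _
    (memLp_two_adjoint_kernel (memLp_two_toSpanSingleton hk)) h] with y hy
  rw [hy]
  simp [ContinuousLinearMap.adjoint_toSpanSingleton]

/-- The Hilbert–Schmidt bound, obtained by applying Bessel's inequality to the slices `k(·, y)`. -/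
theorem sum_norm_sq_adjoint_hilbertSchmidtOp_le {ι : Type*} (k : α → β → F)
    (hk : MemLp (Function.uncurry k) 2 (μ.prod ν)) {e : ι → Lp F 2 μ} (he : Orthonormal ℂ e)
    (s : Finset ι) :
    ∑ i ∈ s, ‖ContinuousLinearMap.adjoint (hilbertSchmidtOp k hk) (e i)‖ ^ 2 ≤
      ∫ y, ∫ x, ‖k x y‖ ^ 2 ∂μ ∂ν := by
  have hk' := memLp_two_swap hk
  simp_rw [L2_norm_sq_eq_integral_coe]
  rw [← integral_finsetSum _ fun i _ => (memLp_two_iff_integrable_sq_norm (Lp.memLp _).1).1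
    (Lp.memLp (ContinuousLinearMap.adjoint (hilbertSchmidtOp k hk) (e i)))]
  refine integral_mono_ae (integrable_finsetSum _ fun i _ =>
    (memLp_two_iff_integrable_sq_norm (Lp.memLp _).1).1 (Lp.memLp _))
    (((memLp_two_iff_integrable_sq_norm hk'.1).1 hk').integral_prod_left) ?_
  filter_upwards [(ae_ball_iff s.countable_toSet).2 fun i _ =>
    adjoint_hilbertSchmidtOp_apply_ae k hk (e i), ae_memLp_two_slice hk'] with y h1 h2
  have h3 : ∀ i ∈ s, ‖ContinuousLinearMap.adjoint (hilbertSchmidtOp k hk) (e i) y‖ ^ 2 =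
      ‖⟪e i, h2.toLp _⟫_ℂ‖ ^ 2 := fun i hi => by
    rw [h1 i hi, norm_inner_symm, L2.inner_def]
    congr 2
    refine integral_congr_ae ?_
    filter_upwards [h2.coeFn_toLp] with x hx
    rw [hx]
  rw [Finset.sum_congr rfl h3]
  refine (he.sum_inner_products_le _).trans ?_
  rw [L2_norm_sq_eq_integral]

/-- `Γ† U Γ` is trace class when `Γ` has a square integrable kernel and `U` preserves inner
products: expand `Γ f` in an orthonormal basis and apply the Hilbert–Schmidt bound to the basis and
to its image under `U`. -/
theorem isTraceClass_adjoint_comp_hilbertSchmidtOp (k : α → β → F)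
    (hk : MemLp (Function.uncurry k) 2 (μ.prod ν)) (U : Lp F 2 μ →L[ℂ] Lp F 2 μ)
    (hU : ∀ f g, ⟪U f, U g⟫_ℂ = ⟪f, g⟫_ℂ) :
    IsTraceClass (ContinuousLinearMap.adjoint (hilbertSchmidtOp k hk) ∘L U ∘L
      hilbertSchmidtOp k hk) := by
  obtain ⟨w, b, -⟩ := exists_hilbertBasis ℂ (Lp F 2 μ)
  set Γ := hilbertSchmidtOp k hk
  have hUb : Orthonormal ℂ fun i => U (b i) := by
    classical
    rw [orthonormal_iff_ite]
    intro i j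
    rw [hU, orthonormal_iff_ite.1 b.orthonormal]
  have hp : Summable fun i => ‖ContinuousLinearMap.adjoint Γ (b i)‖ ^ 2 :=
    summable_of_sum_le (fun _ => sq_nonneg _)
      (sum_norm_sq_adjoint_hilbertSchmidtOp_le k hk b.orthonormal)
  have hq : Summable fun i => ‖ContinuousLinearMap.adjoint Γ (U (b i))‖ ^ 2 :=
    summable_of_sum_le (fun _ => sq_nonneg _) (sum_norm_sq_adjoint_hilbertSchmidtOp_le k hk hUb)
  refine isTraceClass_of_hasSum (fun i => ContinuousLinearMap.adjoint Γ (b i))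
    (fun i => ContinuousLinearMap.adjoint Γ (U (b i)))
    ((hp.add hq).of_nonneg_of_le (fun _ => by positivity) fun i => ?_) fun f => ?_
  · nlinarith [sq_nonneg (‖ContinuousLinearMap.adjoint Γ (b i)‖ -
      ‖ContinuousLinearMap.adjoint Γ (U (b i))‖),
      sq_nonneg ‖ContinuousLinearMap.adjoint Γ (b i)‖,
      sq_nonneg ‖ContinuousLinearMap.adjoint Γ (U (b i))‖]
  · have := (b.hasSum_repr (Γ f)).mapL (ContinuousLinearMap.adjoint Γ ∘L U)
    simpa [HilbertBasis.repr_apply_apply, ContinuousLinearMap.adjoint_inner_left] using this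

/-- The kernel of `Γ† U Γ`, where `U` acts by the pointwise linear map `S`, is
`(x, y) ↦ ∫ ⟪k(s, x), S k(s, y)⟫ ds`. -/
theorem adjoint_comp_hilbertSchmidtOp_apply_ae (k : α → β → F)
    (hk : MemLp (Function.uncurry k) 2 (μ.prod ν)) (S : F →L[ℂ] F) (f : Lp ℂ 2 ν) :
    ∀ᵐ x ∂ν, Integrable (fun y => f y • ∫ s, ⟪k s x, S (k s y)⟫_ℂ ∂μ) ν ∧
      (ContinuousLinearMap.adjoint (hilbertSchmidtOp k hk) ∘L S.compLpL 2 μ ∘L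
        hilbertSchmidtOp k hk) f x = ∫ y, f y • ∫ s, ⟪k s x, S (k s y)⟫_ℂ ∂μ ∂ν := by
  have hSk : MemLp (Function.uncurry fun s y => S (k s y)) 2 (μ.prod ν) := S.comp_memLp' hk
  filter_upwards [adjoint_hilbertSchmidtOp_apply_ae k hk
    (S.compLpL 2 μ (hilbertSchmidtOp k hk f)), ae_memLp_two_slice (memLp_two_swap hk)]
    with x h1 h2
  have hI := integrable_inner_kernel_apply (memLp_two_toSpanSingleton hSk) (Lp.memLp f) h2
  simp only [ContinuousLinearMap.toSpanSingleton_apply, inner_smul_right] at hI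
  have hc : ∀ y, ∫ s, f y * ⟪k s x, S (k s y)⟫_ℂ ∂μ = f y • ∫ s, ⟪k s x, S (k s y)⟫_ℂ ∂μ :=
    fun y => by rw [integral_const_mul, smul_eq_mul]
  refine ⟨by simpa only [hc] using hI.integral_prod_right, ?_⟩
  simp only [← hc]
  rw [ContinuousLinearMap.comp_apply, ContinuousLinearMap.comp_apply, h1,
    ← integral_integral_swap hI]
  refine integral_congr_ae ?_
  filter_upwards [hilbertSchmidtOp_apply_ae k hk f,
    S.coeFn_compLpL (p := 2) (hilbertSchmidtOp k hk f)] with s h3 h4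
  have h5 : Integrable (fun y => f y • S (k s y)) ν := by
    simpa using S.integrable_comp h3.1
  rw [h4, h3.2, ← S.integral_comp_comm h3.1]
  simp only [map_smul]
  rw [← integral_inner h5]
  simp [inner_smul_right]

end HilbertSchmidt

/-! ### Linear algebra of the residues -/

theorem sq_add_sq_le_of_linear_forms (a b c d x y : ℝ) :
    (a * x + b * y) ^ 2 + (c * x + d * y) ^ 2 ≤
      (a ^ 2 + b ^ 2 + c ^ 2 + d ^ 2) * (x ^ 2 + y ^ 2) := by
  nlinarith [sq_nonneg (a * y - b * x), sq_nonneg (c * y - d * x)]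

theorem transpose_mul_sig_mul (a b c d : ℝ) (S : Matrix (Fin 2) (Fin 2) ℝ)
    (h00 : S 0 0 = a ^ 2 - c ^ 2) (h01 : S 0 1 = a * b - c * d) (h10 : S 1 0 = a * b - c * d)
    (h11 : S 1 1 = b ^ 2 - d ^ 2) :
    S = (Matrix.of (Sum.elim (fun _ : Fin 1 => ![a, b]) fun _ : Fin 1 => ![c, d]))ᵀ *
      sig ℝ 1 1 * Matrix.of (Sum.elim (fun _ : Fin 1 => ![a, b]) fun _ : Fin 1 => ![c, d]) := by
  ext i j
  fin_cases i <;> fin_cases j <;>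
    simp [Matrix.mul_apply, sig, Matrix.fromBlocks, h00, h01, h10, h11] <;> ring

/-- The symmetric matrix `J W` has determinant `-θ² / 4 ≤ 0`, so its quadratic form
`-u⁻¹ (x - u y) ((z + θ) x - z u y)` is a difference of two squares of linear forms. The forms
can be chosen to vanish on `ker W` when `θ = 0`, which is the content of the estimate. -/
theorem exists_signature_factorization (z θ u : ℝ) (hu : u ≠ 0) :
    ∃ V : Matrix (Fin 1 ⊕ Fin 1) (Fin 2) ℝ, J * residue z θ u = Vᵀ * sig ℝ 1 1 * V ∧
      ∃ C : ℝ, 0 ≤ C ∧ ∀ v : Plane, ‖toEuclideanLin V v‖ ^ 2 ≤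
        C * (‖toEuclideanLin (residue z θ u) v‖ ^ 2 + θ ^ 2 / 4 * ‖v‖ ^ 2) := by
  by_cases hθ : θ = 0
  · subst hθ
    have key : ∀ a c : ℝ, a ^ 2 - c ^ 2 = -(u⁻¹ * z) → a ^ 2 + c ^ 2 ≤ |u⁻¹ * z| →
        ∃ V : Matrix (Fin 1 ⊕ Fin 1) (Fin 2) ℝ, J * residue z 0 u = Vᵀ * sig ℝ 1 1 * V ∧
          ∃ C : ℝ, 0 ≤ C ∧ ∀ v : Plane, ‖toEuclideanLin V v‖ ^ 2 ≤
            C * (‖toEuclideanLin (residue z 0 u) v‖ ^ 2 + 0 ^ 2 / 4 * ‖v‖ ^ 2) := by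
      intro a c hac hle
      refine ⟨_, transpose_mul_sig_mul a (-(u * a)) c (-(u * c)) _ ?_ ?_ ?_ ?_,
        |u⁻¹ * z| * (z ^ 2)⁻¹, by positivity, fun v => ?_⟩
      · simp [J, residue, Matrix.mul_apply]; linarith
      · have : z = -(u * (a ^ 2 - c ^ 2)) := by rw [hac]; field_simp
        simp [J, residue, Matrix.mul_apply]; linarith
      · have : z = -(u * (a ^ 2 - c ^ 2)) := by rw [hac]; field_simp
        simp [J, residue, Matrix.mul_apply]; linarith
      · have : u * z = -(u ^ 2 * (a ^ 2 - c ^ 2)) := by rw [hac]; field_simp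
        simp [J, residue, Matrix.mul_apply]; linarith
      · simp only [EuclideanSpace.norm_sq_eq, Fintype.sum_sum_type]
        simp [residue, Matrix.mulVec, dotProduct, Fin.sum_univ_two]
        have e1 : (a * v 0 + -(u * a * v 1)) ^ 2 + (c * v 0 + -(u * c * v 1)) ^ 2 =
            (a ^ 2 + c ^ 2) * (v 0 - u * v 1) ^ 2 := by ring
        have e2 : (z * v 0 + -(u * z * v 1)) ^ 2 + (u⁻¹ * z * v 0 + -(z * v 1)) ^ 2 =
            z ^ 2 * (1 + u⁻¹ ^ 2) * (v 0 - u * v 1) ^ 2 := by field_simp; ring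
        rw [e1, e2]
        by_cases hz : z = 0
        · subst hz
          have : a ^ 2 + c ^ 2 ≤ 0 := by simpa using hle
          have h0 : a ^ 2 + c ^ 2 = 0 := le_antisymm this (by positivity)
          simp [h0]
        · calc _ ≤ |u⁻¹ * z| * (v 0 - u * v 1) ^ 2 := by gcongr
            _ ≤ |u⁻¹ * z| * ((1 + u⁻¹ ^ 2) * (v 0 - u * v 1) ^ 2) := by
                gcongr
                nlinarith [mul_nonneg (sq_nonneg u⁻¹) (sq_nonneg (v 0 - u * v 1))]
            _ = _ := by rw [abs_mul, abs_inv]; field_simp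
    rcases le_total (u⁻¹ * z) 0 with h | h
    · refine key √(-(u⁻¹ * z)) 0 ?_ ?_
      · rw [Real.sq_sqrt (by linarith)]; ring
      · rw [Real.sq_sqrt (by linarith), abs_of_nonpos h]; simp
    · refine key 0 √(u⁻¹ * z) ?_ ?_
      · rw [Real.sq_sqrt h]; ring
      · rw [Real.sq_sqrt h, abs_of_nonneg h]; simp
  · -- a product `m n` is the difference of the squares of `(m + n) / 2` and `(m - n) / 2`
    set a := (z + θ - u⁻¹) / 2 with ha
    set b := (1 - z * u) / 2 with hb
    set c := (-u⁻¹ - z - θ) / 2 with hc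
    set d := (1 + z * u) / 2 with hd
    refine ⟨_, transpose_mul_sig_mul a b c d _ ?_ ?_ ?_ ?_,
        (a ^ 2 + b ^ 2 + c ^ 2 + d ^ 2) * (4 / θ ^ 2), by positivity, fun v => ?_⟩
    · simp [J, residue, Matrix.mul_apply, ha, hc]; ring
    · simp [J, residue, Matrix.mul_apply, ha, hb, hc, hd]; field_simp; ring
    · simp [J, residue, Matrix.mul_apply, ha, hb, hc, hd]; field_simp; ring
    · simp [J, residue, Matrix.mul_apply, hb, hd]; ring
    · have h1 : (a ^ 2 + b ^ 2 + c ^ 2 + d ^ 2) * ‖v‖ ^ 2 ≤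
          (a ^ 2 + b ^ 2 + c ^ 2 + d ^ 2) * (4 / θ ^ 2) *
            (‖toEuclideanLin (residue z θ u) v‖ ^ 2 + θ ^ 2 / 4 * ‖v‖ ^ 2) := by
        rw [mul_assoc]
        gcongr
        rw [mul_add]
        have : 4 / θ ^ 2 * (θ ^ 2 / 4 * ‖v‖ ^ 2) = ‖v‖ ^ 2 := by field_simp
        rw [this]
        have : 0 ≤ 4 / θ ^ 2 * ‖toEuclideanLin (residue z θ u) v‖ ^ 2 := by positivity
        linarith
      refine le_trans ?_ h1
      rw [EuclideanSpace.norm_sq_eq, EuclideanSpace.norm_sq_eq, Fintype.sum_sum_type]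
      simpa [Matrix.mulVec, dotProduct, Fin.sum_univ_two] using
        sq_add_sq_le_of_linear_forms a b c d (v 0) (v 1)

/-- `J W` is symmetric because `W` is traceless. -/
theorem inner_J_residue (z θ u : ℝ) (v w : Plane) :
    ⟪toEuclideanLin J v, toEuclideanLin (residue z θ u) w⟫_ℝ =
      -⟪toEuclideanLin (J * residue z θ u) v, w⟫_ℝ := by
  simp [J, residue, dotProduct, Fin.sum_univ_two, PiLp.inner_apply, toLpLin_apply]
  ring

theorem inner_J_self (v : Plane) : ⟪toEuclideanLin J v, v⟫_ℝ = 0 := by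
  simp [J, dotProduct, Fin.sum_univ_two, PiLp.inner_apply, toLpLin_apply]
  ring

theorem residue_residue_apply (z θ u : ℝ) (hu : u ≠ 0) (v : Plane) :
    toEuclideanLin (residue z θ u) (toEuclideanLin (residue z θ u) v) = (θ ^ 2 / 4) • v := by
  ext i
  fin_cases i <;>
  · simp [residue, dotProduct, Fin.sum_univ_two, toLpLin_apply]
    field_simp
    ring

theorem norm_symbol_sq (t : ℝ) (V : Fin 3 → Matrix (Fin 1 ⊕ Fin 1) (Fin 2) ℝ) (Ψ : ℝ → Plane)
    (x : ℝ) :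
    ‖symbol t V Ψ x‖ ^ 2 = ∑ ν, ‖toEuclideanLin (V ν) (Ψ x)‖ ^ 2 / (x - pole t ν) ^ 2 := by
  simp only [EuclideanSpace.norm_sq_eq, Fintype.sum_sum_type, symbol, toLpLin_apply]
  simp [div_pow, add_div, Finset.sum_add_distrib]

theorem inner_sig_symbol (t : ℝ) (V : Fin 3 → Matrix (Fin 1 ⊕ Fin 1) (Fin 2) ℝ)
    (Ψ : ℝ → Plane) (x y : ℝ) :
    ⟪toEuclideanLin (sig ℝ 3 3) (symbol t V Ψ x), symbol t V Ψ y⟫_ℝ =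
      ∑ ν, ⟪toEuclideanLin ((V ν)ᵀ * sig ℝ 1 1 * V ν) (Ψ x), Ψ y⟫_ℝ /
        ((x - pole t ν) * (y - pole t ν)) := by
  simp [PiLp.inner_apply, Fintype.sum_sum_type, symbol, toLpLin_apply, sig, Matrix.fromBlocks_mulVec,
    Matrix.mul_apply, Matrix.mulVec, dotProduct, Fin.sum_univ_two, Fin.sum_univ_three,
    div_eq_mul_inv]
  ring

/-! ### The energy estimate at a regular singular point -/

/-- Bounded solutions of `Ψ' = W Ψ / (x - a) + r` with `W² = c ≥ 0` and bounded `r`: the function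
`⟪W Ψ, Ψ⟫` is bounded, and up to a bounded term its derivative is `(‖W Ψ‖² + c ‖Ψ‖²) / (x - a)`,
which is therefore integrable up to the singular point. No expansion of `Ψ` at `a` is needed, so
resonant and nilpotent residues are covered. -/
theorem integrableOn_Ioc_of_energy_estimate {H : Type*} [NormedAddCommGroup H] [InnerProductSpace ℝ H]
    {W : H →L[ℝ] H} {c : ℝ} (hc : 0 ≤ c) (hW : ∀ v, W (W v) = c • v) {a b M M' : ℝ}
    {Ψ r : ℝ → H} (hΨ : ∀ x ∈ Ioc a b, HasDerivAt Ψ ((x - a)⁻¹ • W (Ψ x) + r x) x)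
    (hM : ∀ x ∈ Ioc a b, ‖Ψ x‖ ≤ M) (hr : ∀ x ∈ Ioc a b, ‖r x‖ ≤ M') :
    IntegrableOn (fun x => (x - a)⁻¹ * (‖W (Ψ x)‖ ^ 2 + c * ‖Ψ x‖ ^ 2)) (Ioc a b) := by
  rcases le_or_gt b a with hab | hab
  · simp [Ioc_eq_empty_of_le hab]
  have hM0 : 0 ≤ M := (norm_nonneg _).trans (hM b ⟨hab, le_rfl⟩)
  have hM0' : 0 ≤ M' := (norm_nonneg _).trans (hr b ⟨hab, le_rfl⟩)
  set f : ℝ → ℝ := fun x => (x - a)⁻¹ * (‖W (Ψ x)‖ ^ 2 + c * ‖Ψ x‖ ^ 2) with hf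
  have hΨc : ContinuousOn Ψ (Ioc a b) := fun x hx => (hΨ x hx).continuousAt.continuousWithinAt
  have hfc : ContinuousOn f (Ioc a b) := by
    have : ∀ x ∈ Ioc a b, x - a ≠ 0 := fun x hx => (sub_pos.2 hx.1).ne'
    fun_prop (disch := assumption)
  have hf0 : ∀ x ∈ Ioc a b, 0 ≤ f x := fun x hx => by
    have := sub_pos.2 hx.1
    positivity
  set L := 2 * (‖W‖ * M' * M) with hL
  have hL0 : 0 ≤ L := by positivity
  -- the quadratic form of `W` serves as energy; `L` bounds the contribution of `r`
  set E : ℝ → ℝ := fun x => ⟪W (Ψ x), Ψ x⟫_ℝ with hE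
  have hEb : ∀ x ∈ Ioc a b, |E x| ≤ ‖W‖ * M * M := fun x hx =>
    (abs_real_inner_le_norm _ _).trans (by
      have := hM x hx
      have := W.le_opNorm (Ψ x)
      have : ‖W (Ψ x)‖ ≤ ‖W‖ * M := this.trans (by gcongr)
      gcongr)
  have hE' : ∀ x ∈ Ioc a b, HasDerivAt (fun x => E x + L * x)
      (f x + (⟪W (Ψ x), r x⟫_ℝ + ⟪W (r x), Ψ x⟫_ℝ) + L) x := fun x hx => by
    have h1 := ((W.hasFDerivAt.comp_hasDerivAt x (hΨ x hx)).inner ℝ (hΨ x hx)).add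
      ((hasDerivAt_id x).const_mul L)
    refine h1.congr_deriv ?_
    simp only [hf, Function.comp_apply, map_add, map_smul, hW, inner_add_left, inner_add_right, inner_smul_left,
      inner_smul_right, real_inner_self_eq_norm_sq, conj_trivial]
    ring
  have hrem : ∀ x ∈ Ioc a b, -L ≤ ⟪W (Ψ x), r x⟫_ℝ + ⟪W (r x), Ψ x⟫_ℝ := fun x hx => by
    have h1 := hM x hx
    have h2 := hr x hx
    have h3 : |⟪W (Ψ x), r x⟫_ℝ| ≤ ‖W‖ * M * M' := (abs_real_inner_le_norm _ _).trans (by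
      gcongr
      exact (W.le_opNorm _).trans (by gcongr))
    have h4 : |⟪W (r x), Ψ x⟫_ℝ| ≤ ‖W‖ * M' * M := (abs_real_inner_le_norm _ _).trans (by
      gcongr
      exact (W.le_opNorm _).trans (by gcongr))
    have := abs_le.1 h3
    have := abs_le.1 h4
    rw [hL]
    linarith
  have key : ∀ ε ∈ Ioo a b, ∫ x in Ioc ε b, ‖f x‖ ≤ 2 * (‖W‖ * M * M) + L * (b - a) := by
    intro ε hε
    have hsub : Icc ε b ⊆ Ioc a b := fun x hx => ⟨hε.1.trans_le hx.1, hx.2⟩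
    have h1 : ∫ x in ε..b, f x ≤ (E b + L * b) - (E ε + L * ε) :=
      intervalIntegral.integral_le_sub_of_hasDeriv_right_of_le hε.2.le
        (fun x hx => (hE' x (hsub hx)).continuousAt.continuousWithinAt)
        (fun x hx => (hE' x (hsub (Ioo_subset_Icc_self hx))).hasDerivWithinAt)
        ((hfc.mono hsub).integrableOn_Icc)
        (fun x hx => by linarith [hrem x (hsub (Ioo_subset_Icc_self hx))])
    rw [intervalIntegral.integral_of_le hε.2.le] at h1
    rw [setIntegral_congr_fun measurableSet_Ioc (g := f) fun x hx => by
      simpa using hf0 x (hsub (Ioc_subset_Icc_self hx))]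
    have h2 := abs_le.1 (hEb b ⟨hab, le_rfl⟩)
    have h3 := abs_le.1 (hEb ε ⟨hε.1, hε.2.le⟩)
    have h4 : L * a ≤ L * ε := mul_le_mul_of_nonneg_left hε.1.le hL0
    linarith
  have hδ : ∀ n : ℕ, a + (b - a) / (n + 2) ∈ Ioo a b := fun n => by
    have h1 : 0 < (b - a) / ((n : ℝ) + 2) := div_pos (sub_pos.2 hab) (by positivity)
    have h2 : (b - a) / ((n : ℝ) + 2) < b - a :=
      div_lt_self (sub_pos.2 hab) (by have := n.cast_nonneg (α := ℝ); linarith)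
    constructor <;> linarith
  refine integrableOn_Ioc_of_intervalIntegral_norm_bounded_left (l := Filter.atTop)
    (a := fun n : ℕ => a + (b - a) / (n + 2)) (I := 2 * (‖W‖ * M * M) + L * (b - a))
    (fun n => ?_) ?_ (Filter.Eventually.of_forall fun n => key _ (hδ n))
  · exact ((hfc.mono fun x hx => ⟨(hδ n).1.trans_le hx.1, hx.2⟩).integrableOn_Icc).mono_set
      Ioc_subset_Icc_self
  · have h1 : Filter.Tendsto (fun n : ℕ => (b - a) / ((n : ℝ) + 2)) Filter.atTop (nhds 0) :=
      tendsto_const_nhds.div_atTop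
        (Filter.tendsto_atTop_add_const_right _ _ tendsto_natCast_atTop_atTop)
    simpa using h1.const_add a

/-! ### Bounded solutions of the Fuchsian system -/

/-- A matrix as a bounded operator between Euclidean spaces. -/
def matrixCLM {m n : Type} [Fintype m] [Fintype n] [DecidableEq n] (A : Matrix m n ℝ) :
    EuclideanSpace ℝ n →L[ℝ] EuclideanSpace ℝ m :=
  LinearMap.toContinuousLinearMap (toEuclideanLin A)

theorem matrixCLM_apply {m n : Type} [Fintype m] [Fintype n] [DecidableEq n] (A : Matrix m n ℝ)
    (v : EuclideanSpace ℝ n) : matrixCLM A v = toEuclideanLin A v := rfl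

theorem pole_le {t : ℝ} (ht : 1 < t) (ν : Fin 3) : pole t ν ≤ t := by
  fin_cases ν <;> simp [pole] <;> linarith

theorem sub_pole_pos {t x : ℝ} (ht : 1 < t) (hx : t < x) (ν : Fin 3) : 0 < x - pole t ν := by
  linarith [pole_le ht ν]

theorem coeff_apply (θ : Fin 3 → ℝ) (z u : Fin 3 → ℝ → ℝ) (t x : ℝ) (v : Plane) :
    toEuclideanLin (coeff θ z u t x) v =
      ∑ ν, (x - pole t ν)⁻¹ • matrixCLM (W θ z u t ν) v := by
  simp [coeff, matrixCLM_apply]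

section Solution

variable {θ : Fin 3 → ℝ} {z u : Fin 3 → ℝ → ℝ} {t M : ℝ} {Ψ : ℝ → Plane}
  {V : Fin 3 → Matrix (Fin 1 ⊕ Fin 1) (Fin 2) ℝ}

theorem continuousOn_symbol (ht : 1 < t) (hΨ : ContinuousOn Ψ (Ioi t)) :
    ContinuousOn (symbol t V Ψ) (Ioi t) := by
  refine (PiLp.continuous_toLp 2 _).comp_continuousOn (continuousOn_pi.2 fun i => ?_)
  have h : ∀ ν i, ContinuousOn (fun x => (V ν *ᵥ (Ψ x).ofLp) i / (x - pole t ν)) (Ioi t) :=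
    fun ν i => by
      refine ContinuousOn.div ?_ (by fun_prop) fun x hx => (sub_pole_pos ht hx ν).ne'
      have : Continuous fun v : Plane => (V ν *ᵥ v.ofLp) i := by fun_prop
      exact this.comp_continuousOn hΨ
  rcases i with ν | ν
  · exact h ν _
  · exact h ν _

/-- Near `t` the energy estimate applies to the residue at `t`, while the other two terms are
bounded there; at infinity all the terms are controlled by the square integrability of `Ψ` for
`dx / x`. -/
theorem integrableOn_weight_mul_norm_symbol_sq (ht : 1 < t) (hu : u 2 t ≠ 0)
    (hode : ∀ x > t, HasDerivAt Ψ (toEuclideanLin (coeff θ z u t x) (Ψ x)) x)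
    (hM : ∀ x > t, ‖Ψ x‖ ≤ M) (hint : IntegrableOn (fun x => x⁻¹ * ‖Ψ x‖ ^ 2) (Ioi t))
    (hV : ∃ C : ℝ, 0 ≤ C ∧ ∀ v : Plane, ‖toEuclideanLin (V 2) v‖ ^ 2 ≤
      C * (‖toEuclideanLin (W θ z u t 2) v‖ ^ 2 + θ 2 ^ 2 / 4 * ‖v‖ ^ 2)) :
    IntegrableOn (fun x => (x - t) * ‖symbol t V Ψ x‖ ^ 2) (Ioi t) := by
  have hΨc : ContinuousOn Ψ (Ioi t) := fun x hx => (hode x hx).continuousAt.continuousWithinAt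
  have hM0 : 0 ≤ M := (norm_nonneg _).trans (hM (t + 1) (by simp))
  set g : Fin 3 → ℝ → ℝ := fun ν x =>
    (x - t) * (‖matrixCLM (V ν) (Ψ x)‖ ^ 2 / (x - pole t ν) ^ 2) with hg
  have hgc : ∀ ν, ContinuousOn (g ν) (Ioi t) := fun ν => by
    have : ∀ x ∈ Ioi t, (x - pole t ν) ^ 2 ≠ 0 := fun x hx => by
      have := sub_pole_pos ht hx ν
      positivity
    fun_prop (disch := assumption)
  -- comparison with `‖Ψ‖² / x` where `x - ν` is bounded below by a multiple of `x`
  have hcmp : ∀ (ν : Fin 3) (s : Set ℝ) (c : ℝ), MeasurableSet s → s ⊆ Ioi t → 0 < c →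
      (∀ x ∈ s, c * x ≤ x - pole t ν) → IntegrableOn (g ν) s := fun ν s c hs hst hc h => by
    refine ((hint.mono_set hst).const_mul (c⁻¹ * ‖matrixCLM (V ν)‖ ^ 2)).mono'
      (((hgc ν).mono hst).aestronglyMeasurable hs) ?_
    filter_upwards [ae_restrict_mem hs] with x hx
    have hxt : t < x := hst hx
    have hx0 : 0 < x := by linarith
    have hxt' := sub_pos.2 hxt
    have hp := sub_pole_pos ht hxt ν
    have h1 : ‖matrixCLM (V ν) (Ψ x)‖ ^ 2 ≤ ‖matrixCLM (V ν)‖ ^ 2 * ‖Ψ x‖ ^ 2 := by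
      rw [← mul_pow]
      gcongr
      exact (matrixCLM (V ν)).le_opNorm _
    rw [Real.norm_of_nonneg (by positivity)]
    calc g ν x ≤ (x - pole t ν) * (‖matrixCLM (V ν)‖ ^ 2 * ‖Ψ x‖ ^ 2 / (x - pole t ν) ^ 2) := by
          simp only [hg]
          gcongr
          exact pole_le ht ν
      _ = (x - pole t ν)⁻¹ * (‖matrixCLM (V ν)‖ ^ 2 * ‖Ψ x‖ ^ 2) := by field_simp
      _ ≤ (c * x)⁻¹ * (‖matrixCLM (V ν)‖ ^ 2 * ‖Ψ x‖ ^ 2) := by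
          gcongr
          exact h x hx
      _ = _ := by rw [mul_inv]; ring
  have h0 : IntegrableOn (g 0) (Ioi t) :=
    hcmp 0 _ 1 measurableSet_Ioi subset_rfl one_pos fun x _ => by simp [pole]
  have h1 : IntegrableOn (g 1) (Ioi t) :=
    hcmp 1 _ (1 - t⁻¹) measurableSet_Ioi subset_rfl (sub_pos.2 (inv_lt_one_of_one_lt₀ ht))
      fun x hx => by
        have h2 : 1 ≤ t⁻¹ * x := by
          rw [inv_mul_eq_div, one_le_div (by linarith)]
          exact (mem_Ioi.1 hx).le
        simp only [pole, cons_val_one, cons_val_zero]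
        linarith
  have h2 : IntegrableOn (g 2) (Ioi t) := by
    rw [← Ioc_union_Ioi_eq_Ioi (show t ≤ t + 1 by linarith)]
    refine IntegrableOn.union ?_ (hcmp 2 _ (1 + t)⁻¹ measurableSet_Ioi
      (Ioi_subset_Ioi (by linarith)) (by positivity) fun x hx => ?_)
    · obtain ⟨C, hC, hVC⟩ := hV
      have hE := integrableOn_Ioc_of_energy_estimate (W := matrixCLM (W θ z u t 2))
        (c := θ 2 ^ 2 / 4) (by positivity) (fun v => residue_residue_apply _ _ _ hu v)
        (a := t) (b := t + 1) (M := M)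
        (M' := ‖matrixCLM (W θ z u t 0)‖ * M + (t - 1)⁻¹ * (‖matrixCLM (W θ z u t 1)‖ * M))
        (Ψ := Ψ) (r := fun x => x⁻¹ • matrixCLM (W θ z u t 0) (Ψ x) +
          (x - 1)⁻¹ • matrixCLM (W θ z u t 1) (Ψ x)) (fun x hx => by
            refine (hode x hx.1).congr_deriv ?_
            rw [coeff_apply, Fin.sum_univ_three]
            simp only [pole, cons_val_zero, cons_val_one, cons_val, sub_zero]
            abel) (fun x hx => hM x hx.1) (fun x hx => by
            have hx1 : 1 ≤ x := by linarith [hx.1]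
            have hb : ∀ ν, ‖matrixCLM (W θ z u t ν) (Ψ x)‖ ≤ ‖matrixCLM (W θ z u t ν)‖ * M :=
              fun ν => (ContinuousLinearMap.le_opNorm _ _).trans (by gcongr; exact hM x hx.1)
            have ht1 : 0 < t - 1 := by linarith
            refine (norm_add_le _ _).trans (add_le_add ?_ ?_)
            · rw [norm_smul, norm_inv, Real.norm_of_nonneg (by linarith)]
              exact (mul_le_of_le_one_left (norm_nonneg _) (inv_le_one_of_one_le₀ hx1)).trans (hb 0)
            · rw [norm_smul, norm_inv, Real.norm_of_nonneg (by linarith [hx.1])]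
              gcongr
              · exact hx.1.le
              · exact hb 1)
      refine (hE.const_mul C).mono' (((hgc 2).mono Ioc_subset_Ioi_self).aestronglyMeasurable
        measurableSet_Ioc) ?_
      filter_upwards [ae_restrict_mem measurableSet_Ioc] with x hx
      have hxt := sub_pos.2 hx.1
      have hp : pole t 2 = t := by simp [pole]
      rw [Real.norm_of_nonneg (by positivity)]
      calc g 2 x = (x - t)⁻¹ * ‖matrixCLM (V 2) (Ψ x)‖ ^ 2 := by
            simp only [hg, hp]; field_simp
        _ ≤ (x - t)⁻¹ * (C * (‖matrixCLM (W θ z u t 2) (Ψ x)‖ ^ 2 + θ 2 ^ 2 / 4 * ‖Ψ x‖ ^ 2)) := by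
            gcongr
            exact hVC _
        _ = _ := by ring
    · have hp : pole t 2 = t := by simp [pole]
      rw [hp, inv_mul_le_iff₀ (by linarith)]
      have := mem_Ioi.1 hx
      nlinarith
  refine ((h0.add h1).add h2).congr_fun (fun x _ => ?_) measurableSet_Ioi
  simp only [norm_symbol_sq, Fin.sum_univ_three, mul_add, hg, matrixCLM_apply, Pi.add_apply]

theorem hasDerivAt_inner_J
    (hode : ∀ x > t, HasDerivAt Ψ (toEuclideanLin (coeff θ z u t x) (Ψ x)) x) {x y s : ℝ}
    (hx : t < x + s) (hy : t < y + s) :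
    HasDerivAt (fun s => ⟪toEuclideanLin J (Ψ (x + s)), Ψ (y + s)⟫_ℝ)
      (∑ ν, ((x + s - pole t ν)⁻¹ - (y + s - pole t ν)⁻¹) *
        ⟪toEuclideanLin (J * W θ z u t ν) (Ψ (x + s)), Ψ (y + s)⟫_ℝ) s := by
  have h1 := ((matrixCLM J).hasFDerivAt.comp_hasDerivAt s ((hode _ hx).comp_const_add x s)).inner ℝ
    ((hode _ hy).comp_const_add y s)
  refine h1.congr_deriv ?_
  rw [coeff_apply, coeff_apply, map_sum, sum_inner, inner_sum, ← Finset.sum_add_distrib]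
  refine Finset.sum_congr rfl fun ν _ => ?_
  rw [map_smul, inner_smul_left, inner_smul_right]
  simp only [Function.comp_apply, matrixCLM_apply]
  rw [W, inner_J_residue]
  simp [toLpLin_mul_same]
  ring

/-- Along the diagonal translation the kernel has derivative `-⟪σ φ(x + s), φ(y + s)⟫`: the partial
fractions in `s` combine because
`(1 / (a - ν) - 1 / (b - ν)) / (a - b) = -1 / ((a - ν) (b - ν))`. -/
theorem hasDerivAt_kernel_add (ht : 1 < t)
    (hode : ∀ x > t, HasDerivAt Ψ (toEuclideanLin (coeff θ z u t x) (Ψ x)) x)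
    (hV : ∀ ν, J * W θ z u t ν = (V ν)ᵀ * sig ℝ 1 1 * V ν) {x y s : ℝ}
    (hx : t < x + s) (hy : t < y + s) (hxy : x ≠ y) :
    HasDerivAt (fun s => kernel Ψ (x + s) (y + s))
      (-⟪toEuclideanLin (sig ℝ 3 3) (symbol t V Ψ (x + s)), symbol t V Ψ (y + s)⟫_ℝ) s := by
  have h1 := (hasDerivAt_inner_J hode hx hy).div_const (x - y)
  have h2 : (fun s => kernel Ψ (x + s) (y + s)) =
      fun s => ⟪toEuclideanLin J (Ψ (x + s)), Ψ (y + s)⟫_ℝ / (x - y) := by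
    funext s
    rw [kernel, add_sub_add_right_eq_sub]
  rw [h2]
  refine h1.congr_deriv ?_
  rw [inner_sig_symbol, Finset.sum_div, ← Finset.sum_neg_distrib]
  refine Finset.sum_congr rfl fun ν _ => ?_
  have hx' := (sub_pole_pos ht hx ν).ne'
  have hy' := (sub_pole_pos ht hy ν).ne'
  have hxy' := sub_ne_zero.2 hxy
  rw [hV]
  field_simp
  ring

/-- Since `⟪J v, v⟫ = 0`, only the difference `Ψ(x + s) - Ψ(y + s)` matters, and it tends to `0`
because `Ψ` is bounded and `Ψ'(ξ) = O(1 / ξ)`. -/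
theorem tendsto_kernel_add_atTop (ht : 1 < t)
    (hode : ∀ x > t, HasDerivAt Ψ (toEuclideanLin (coeff θ z u t x) (Ψ x)) x)
    (hM : ∀ x > t, ‖Ψ x‖ ≤ M) {x y : ℝ} (hx : t < x) (hy : t < y) :
    Filter.Tendsto (fun s => kernel Ψ (x + s) (y + s)) Filter.atTop (nhds 0) := by
  have hM0 : 0 ≤ M := (norm_nonneg _).trans (hM x hx)
  set L := ∑ ν, ‖matrixCLM (W θ z u t ν)‖ with hL
  have hL0 : 0 ≤ L := Finset.sum_nonneg fun _ _ => norm_nonneg _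
  have hm : t < min x y := lt_min hx hy
  have hdiff : ∀ s, 0 ≤ s →
      ‖Ψ (x + s) - Ψ (y + s)‖ ≤ L * M * |x - y| * (s + (min x y - t))⁻¹ := fun s hs => by
    have h1 := (convex_Ici (min x y + s)).norm_image_sub_le_of_norm_hasDerivWithin_le (f := Ψ)
      (f' := fun ξ => toEuclideanLin (coeff θ z u t ξ) (Ψ ξ))
      (C := (s + (min x y - t))⁻¹ * (L * M)) (x := y + s) (y := x + s)
      (fun ξ hξ => (hode ξ (by linarith [mem_Ici.1 hξ])).hasDerivWithinAt) (fun ξ hξ => ?_)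
      (by simp) (by simp)
    · refine h1.trans_eq ?_
      rw [add_sub_add_right_eq_sub, Real.norm_eq_abs]
      ring
    · have hξ' : t < ξ := by linarith [mem_Ici.1 hξ]
      rw [coeff_apply, hL, Finset.sum_mul, Finset.mul_sum]
      refine norm_sum_le_of_le _ fun ν _ => ?_
      have hp := sub_pole_pos ht hξ' ν
      rw [norm_smul, norm_inv, Real.norm_of_nonneg hp.le]
      have : 0 < s + (min x y - t) := by linarith
      gcongr
      · linarith [mem_Ici.1 hξ, pole_le ht ν]
      · exact (ContinuousLinearMap.le_opNorm _ _).trans (by gcongr; exact hM ξ hξ')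
  have hlim : Filter.Tendsto (fun s => ‖matrixCLM J‖ * (L * M * |x - y| * (s + (min x y - t))⁻¹) * M
      * |x - y|⁻¹) Filter.atTop (nhds 0) := by
    have h1 : Filter.Tendsto (fun s : ℝ => (s + (min x y - t))⁻¹) Filter.atTop (nhds 0) :=
      tendsto_inv_atTop_zero.comp (Filter.tendsto_atTop_add_const_right _ _ Filter.tendsto_id)
    simpa using (((h1.const_mul (L * M * |x - y|)).const_mul ‖matrixCLM J‖).mul_const M).mul_const
      |x - y|⁻¹
  refine squeeze_zero_norm' ?_ hlim
  filter_upwards [Filter.eventually_ge_atTop 0] with s hs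
  have h1 : ⟪toEuclideanLin J (Ψ (x + s)), Ψ (y + s)⟫_ℝ =
      ⟪matrixCLM J (Ψ (x + s) - Ψ (y + s)), Ψ (y + s)⟫_ℝ := by
    rw [map_sub, inner_sub_left, matrixCLM_apply, matrixCLM_apply, inner_J_self, sub_zero]
  rw [kernel, add_sub_add_right_eq_sub, h1, norm_div, Real.norm_eq_abs (x - y), div_eq_mul_inv]
  gcongr
  refine (norm_inner_le_norm _ _).trans ?_
  gcongr
  · exact ((matrixCLM J).le_opNorm _).trans (by gcongr; exact hdiff s hs)
  · exact hM _ (by linarith)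

end Solution

/-! ### Hankel kernels and weighted square integrability -/

/-- A Hankel kernel `φ(s + x)` is square integrable over `s > 0`, `x > t` when `φ` is square
integrable for `(y - t) dy`: for given `y = s + x` the variable `x` ranges over an interval of
length `y - t`. -/
theorem memLp_two_hankel {G : Type*} [NormedAddCommGroup G] {φ : ℝ → G} {t : ℝ}
    (hφ : ContinuousOn φ (Ioi t)) (hint : IntegrableOn (fun x => (x - t) * ‖φ x‖ ^ 2) (Ioi t)) :
    MemLp (Function.uncurry fun s x => φ (s + x)) 2
      ((volume.restrict (Ioi (0 : ℝ))).prod (volume.restrict (Ioi t))) := by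
  set g : ℝ → ENNReal := (Ioi t).indicator fun y => ‖‖φ y‖ ^ 2‖ₑ with hg
  have hgm : Measurable g := by
    have hc : ContinuousOn (fun y => ‖φ y‖ ^ 2) (Ioi t) := by fun_prop
    have h1 : g = fun y => ‖(Ioi t).piecewise (fun y => ‖φ y‖ ^ 2) (fun _ => (0 : ℝ)) y‖ₑ := by
      funext y
      by_cases hy : y ∈ Ioi t <;> simp [hg, hy]
    rw [h1]
    exact (ContinuousOn.measurable_piecewise hc continuousOn_const measurableSet_Ioi).enorm
  have hm : AEStronglyMeasurable (Function.uncurry fun s x => φ (s + x))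
      ((volume.restrict (Ioi (0 : ℝ))).prod (volume.restrict (Ioi t))) := by
    rw [Measure.prod_restrict]
    refine ContinuousOn.aestronglyMeasurable (hφ.comp (by fun_prop) fun p hp => ?_)
      (measurableSet_Ioi.prod measurableSet_Ioi)
    have h1 : 0 < p.1 := hp.1
    have h2 : t < p.2 := hp.2
    exact mem_Ioi.2 (by linarith)
  rw [memLp_two_iff_integrable_sq_norm hm]
  refine ⟨hm.norm.pow 2, ?_⟩
  have hslice : ∀ x ∈ Ioi t, ∫⁻ s in Ioi (0 : ℝ), ‖‖φ (s + x)‖ ^ 2‖ₑ =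
      ∫⁻ y, (Ioi x).indicator g y := fun x hx => by
    rw [← lintegral_add_right_eq_self ((Ioi x).indicator g) x,
      ← lintegral_indicator measurableSet_Ioi]
    refine lintegral_congr fun s => ?_
    by_cases hs : 0 < s
    · have : t < s + x := by linarith [mem_Ioi.1 hx]
      simp [hs, hg, this]
    · simp [hs]
  have hswap : Measurable (Function.uncurry fun x y : ℝ => (Ioi x).indicator g y) := by
    have : (Function.uncurry fun x y : ℝ => (Ioi x).indicator g y) =
        {p : ℝ × ℝ | p.1 < p.2}.indicator fun p => g p.2 := by
      funext p
      by_cases hp : p.1 < p.2 <;> simp [Function.uncurry, hp]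
    rw [this]
    exact (hgm.comp measurable_snd).indicator (measurableSet_lt measurable_fst measurable_snd)
  have hint' := hint.2
  unfold HasFiniteIntegral at hint' ⊢
  have hm2 : AEMeasurable (fun p : ℝ × ℝ => ‖‖Function.uncurry (fun s x => φ (s + x)) p‖ ^ 2‖ₑ)
      ((volume.restrict (Ioi (0 : ℝ))).prod (volume.restrict (Ioi t))) := (hm.norm.pow 2).enorm
  rw [lintegral_prod_symm _ hm2]
  simp only [Function.uncurry]
  rw [setLIntegral_congr_fun measurableSet_Ioi hslice,
    lintegral_lintegral_swap hswap.aemeasurable]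
  refine lt_of_le_of_lt (le_of_eq ?_) hint'
  rw [← lintegral_indicator measurableSet_Ioi]
  refine lintegral_congr fun y => ?_
  have h1 : ∀ x : ℝ, (Ioi x).indicator g y = (Iio y).indicator (fun _ => g y) x := fun x => by
    by_cases h : x < y <;> simp [h]
  simp only [h1]
  rw [lintegral_indicator measurableSet_Iio, Measure.restrict_restrict measurableSet_Iio,
    setLIntegral_const, Iio_inter_Ioi, Real.volume_Ioo]
  by_cases hy : t < y
  · simp only [hg, indicator_of_mem (mem_Ioi.2 hy), enorm_mul]
    rw [mul_comm, Real.enorm_of_nonneg (sub_pos.2 hy).le]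
  · simp [hg, hy]

theorem memLp_two_weightedHalfLine {G : Type*} [NormedAddCommGroup G] {φ : ℝ → G}
    {t : ℝ} (hφ : ContinuousOn φ (Ioi t))
    (hint : IntegrableOn (fun x => (x - t) * ‖φ x‖ ^ 2) (Ioi t)) :
    MemLp (fun x => φ (t + x)) 2 weightedHalfLine := by
  have hm : AEStronglyMeasurable (fun x => φ (t + x)) (volume.restrict (Ioi (0 : ℝ))) :=
    ContinuousOn.aestronglyMeasurable (hφ.comp (by fun_prop) fun x hx => by
      simpa using hx) measurableSet_Ioi
  rw [weightedHalfLine,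
    memLp_two_iff_integrable_sq_norm (hm.mono_ac (withDensity_absolutelyContinuous _ _)),
    integrable_withDensity_iff_integrable_smul' (by fun_prop)
      (Filter.Eventually.of_forall fun _ => ENNReal.ofReal_lt_top)]
  have h1 : IntegrableOn (fun x => (t + x - t) * ‖φ (t + x)‖ ^ 2) (Ioi 0) := by
    have := (measurePreserving_add_left volume t).integrableOn_comp_preimage
      (measurableEmbedding_addLeft t) (f := fun x => (x - t) * ‖φ x‖ ^ 2) (s := Ioi t)
    simpa [Function.comp_def] using this.2 hint
  refine h1.congr_fun (fun x hx => ?_) measurableSet_Ioi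
  simp [ENNReal.toReal_ofReal (mem_Ioi.1 hx).le]

theorem memLp_two_add_of_weighted {G : Type*} [NormedAddCommGroup G] {φ : ℝ → G} {t x : ℝ}
    (hφ : ContinuousOn φ (Ioi t)) (hint : IntegrableOn (fun x => (x - t) * ‖φ x‖ ^ 2) (Ioi t))
    (hx : t < x) : MemLp (fun s => φ (x + s)) 2 (volume.restrict (Ioi (0 : ℝ))) := by
  have hc : ContinuousOn φ (Ioi x) := hφ.mono (Ioi_subset_Ioi hx.le)
  have hm : AEStronglyMeasurable (fun s => φ (x + s)) (volume.restrict (Ioi (0 : ℝ))) :=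
    ContinuousOn.aestronglyMeasurable (hc.comp (by fun_prop) fun s hs => by
      simpa using hs) measurableSet_Ioi
  rw [memLp_two_iff_integrable_sq_norm hm]
  have h1 : IntegrableOn (fun y => ‖φ y‖ ^ 2) (Ioi x) := by
    refine ((hint.mono_set (Ioi_subset_Ioi hx.le)).const_mul (x - t)⁻¹).mono'
      ((hc.norm.pow 2).aestronglyMeasurable measurableSet_Ioi) ?_
    filter_upwards [ae_restrict_mem measurableSet_Ioi] with y hy
    have h2 : x < y := hy
    have h3 : 0 < x - t := sub_pos.2 hx
    rw [Real.norm_of_nonneg (by positivity), ← mul_assoc]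
    refine le_mul_of_one_le_left (by positivity) ?_
    rw [inv_mul_eq_div, one_le_div h3]
    linarith
  have := (measurePreserving_add_left volume x).integrableOn_comp_preimage
    (measurableEmbedding_addLeft x) (f := fun y => ‖φ y‖ ^ 2) (s := Ioi x)
  simpa [Function.comp_def, IntegrableOn] using this.2 h1

/-! ### Complexification and the signature matrix -/

theorem inner_complexify (v w : Six ℝ) : ⟪complexify v, complexify w⟫_ℂ = ((⟪v, w⟫_ℝ : ℝ) : ℂ) := by
  simp [complexify, PiLp.inner_apply]

theorem norm_complexify (v : Six ℝ) : ‖complexify v‖ = ‖v‖ := by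
  simp [complexify, EuclideanSpace.norm_eq]

theorem continuous_complexify : Continuous complexify := by
  unfold complexify
  fun_prop

theorem sig_complexify (v : Six ℝ) :
    toEuclideanCLM (𝕜 := ℂ) (sig ℂ 3 3) (complexify v) =
      complexify (toEuclideanLin (sig ℝ 3 3) v) := by
  ext i
  rcases i with i | i <;>
  simp [complexify, toLpLin_apply, sig, Matrix.fromBlocks_mulVec, Matrix.neg_mulVec]

theorem inner_sig_left (v w : Six ℝ) :
    ⟪v, toEuclideanLin (sig ℝ 3 3) w⟫_ℝ = ⟪toEuclideanLin (sig ℝ 3 3) v, w⟫_ℝ := by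
  simp [PiLp.inner_apply, toLpLin_apply, sig, Matrix.fromBlocks_mulVec,
    Matrix.neg_mulVec, mul_comm]

theorem inner_sigOp (b : ℝ) (f g : L2 b (Six ℂ)) : ⟪sigOp b f, sigOp b g⟫_ℂ = ⟪f, g⟫_ℂ := by
  rw [L2.inner_def, L2.inner_def]
  refine integral_congr_ae ?_
  filter_upwards [(toEuclideanCLM (𝕜 := ℂ) (sig ℂ 3 3)).coeFn_compLpL (p := 2) f,
    (toEuclideanCLM (𝕜 := ℂ) (sig ℂ 3 3)).coeFn_compLpL (p := 2) g] with x hf hg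
  rw [sigOp, hf, hg]
  simp [PiLp.inner_apply, sig, Matrix.fromBlocks_mulVec, Matrix.ofLp_toEuclideanCLM, Matrix.neg_mulVec]

/-! ### The factorization of the kernel -/

section Solution

variable {θ : Fin 3 → ℝ} {z u : Fin 3 → ℝ → ℝ} {t M : ℝ} {Ψ : ℝ → Plane}
  {V : Fin 3 → Matrix (Fin 1 ⊕ Fin 1) (Fin 2) ℝ}

/-- Integrate the derivative of `kernel Ψ (x + s) (y + s)` over `s > 0`. -/
theorem kernel_eq_integral (ht : 1 < t)
    (hode : ∀ x > t, HasDerivAt Ψ (toEuclideanLin (coeff θ z u t x) (Ψ x)) x)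
    (hM : ∀ x > t, ‖Ψ x‖ ≤ M)
    (hV : ∀ ν, J * W θ z u t ν = (V ν)ᵀ * sig ℝ 1 1 * V ν)
    (hint : IntegrableOn (fun x => (x - t) * ‖symbol t V Ψ x‖ ^ 2) (Ioi t)) {x y : ℝ}
    (hx : t < x) (hy : t < y) (hxy : x ≠ y) :
    IntegrableOn (fun s => ⟪toEuclideanLin (sig ℝ 3 3) (symbol t V Ψ (x + s)),
      symbol t V Ψ (y + s)⟫_ℝ) (Ioi 0) ∧
    kernel Ψ x y = ∫ s in Ioi (0 : ℝ), ⟪toEuclideanLin (sig ℝ 3 3) (symbol t V Ψ (x + s)),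
      symbol t V Ψ (y + s)⟫_ℝ := by
  have hφ : ContinuousOn (symbol t V Ψ) (Ioi t) :=
    continuousOn_symbol ht fun x hx => (hode x hx).continuousAt.continuousWithinAt
  have hI : IntegrableOn (fun s => ⟪toEuclideanLin (sig ℝ 3 3) (symbol t V Ψ (x + s)),
      symbol t V Ψ (y + s)⟫_ℝ) (Ioi 0) := by
    have h1 := (matrixCLM (sig ℝ 3 3)).comp_memLp' (memLp_two_add_of_weighted hφ hint hx)
    have h2 := memLp_two_add_of_weighted hφ hint hy
    refine (h1.norm.integrable_mul h2.norm).mono' (h1.1.inner h2.1)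
      (Filter.Eventually.of_forall fun s => norm_inner_le_norm _ _)
  refine ⟨hI, ?_⟩
  have hd : ∀ s, 0 ≤ s → HasDerivAt (fun s => kernel Ψ (x + s) (y + s))
      (-⟪toEuclideanLin (sig ℝ 3 3) (symbol t V Ψ (x + s)), symbol t V Ψ (y + s)⟫_ℝ) s :=
    fun s hs => hasDerivAt_kernel_add ht hode hV (by linarith) (by linarith) hxy
  have h3 := integral_Ioi_of_hasDerivAt_of_tendsto (a := 0) (hd 0 le_rfl).continuousAt.continuousWithinAt
    (fun s hs => hd s (le_of_lt hs)) hI.neg (tendsto_kernel_add_atTop ht hode hM hx hy)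
  rw [integral_neg] at h3
  simp only [add_zero, zero_sub, neg_inj] at h3
  exact h3.symm

/-- The kernel factors through the Hankel operator of the symbol. -/
theorem exists_hankel_factorization (ht : 1 < t)
    (hode : ∀ x > t, HasDerivAt Ψ (toEuclideanLin (coeff θ z u t x) (Ψ x)) x)
    (hM : ∀ x > t, ‖Ψ x‖ ≤ M)
    (hV : ∀ ν, J * W θ z u t ν = (V ν)ᵀ * sig ℝ 1 1 * V ν)
    (hint : IntegrableOn (fun x => (x - t) * ‖symbol t V Ψ x‖ ^ 2) (Ioi t)) :
    ∃ (K : L2 t ℂ →L[ℂ] L2 t ℂ) (Γ : L2 t ℂ →L[ℂ] L2 0 (Six ℂ)),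
      IsIntegralOperator K (fun x y => (kernel Ψ x y : ℂ)) ∧
      IsIntegralOperator Γ (fun s x => complexify (symbol t V Ψ (s + x))) ∧
      K = ContinuousLinearMap.adjoint Γ ∘L sigOp 0 ∘L Γ ∧ IsTraceClass K := by
  have hφ : ContinuousOn (symbol t V Ψ) (Ioi t) :=
    continuousOn_symbol ht fun x hx => (hode x hx).continuousAt.continuousWithinAt
  have hk : MemLp (Function.uncurry fun s x => complexify (symbol t V Ψ (s + x))) 2
      ((volume.restrict (Ioi (0 : ℝ))).prod (volume.restrict (Ioi t))) :=
    memLp_two_hankel (continuous_complexify.comp_continuousOn hφ)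
      (by simpa only [Function.comp_apply, norm_complexify] using hint)
  refine ⟨_, hilbertSchmidtOp _ hk, fun f => ?_, hilbertSchmidtOp_apply_ae _ hk, rfl,
    isTraceClass_adjoint_comp_hilbertSchmidtOp _ hk _ (inner_sigOp 0)⟩
  filter_upwards [adjoint_comp_hilbertSchmidtOp_apply_ae _ hk (toEuclideanCLM (𝕜 := ℂ) (sig ℂ 3 3)) f,
    ae_restrict_mem measurableSet_Ioi] with x hx hxt
  have hae : (fun y => f y • ∫ s in Ioi (0 : ℝ), ⟪complexify (symbol t V Ψ (s + x)),
      toEuclideanCLM (𝕜 := ℂ) (sig ℂ 3 3) (complexify (symbol t V Ψ (s + y)))⟫_ℂ)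
      =ᵐ[volume.restrict (Ioi t)] fun y => f y • (kernel Ψ x y : ℂ) := by
    filter_upwards [ae_restrict_mem measurableSet_Ioi,
      ae_restrict_of_ae (Measure.ae_ne volume x)] with y hy hyx
    rw [(kernel_eq_integral ht hode hM hV hint hxt hy hyx.symm).2, ← integral_complex_ofReal]
    simp only [sig_complexify, inner_complexify, inner_sig_left, add_comm x, add_comm y]
  exact ⟨hx.1.congr hae, hx.2.trans (integral_congr_ae hae)⟩

end Solution

/-! ### The deformation equation -/

/-- The `t`-derivative of the kernel is `⟪J W_t Φ(x), Φ(y)⟫ / ((x - t) (y - t))`. -/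
theorem hasDerivAt_kernel_param {θ : Fin 3 → ℝ} {z u : Fin 3 → ℝ → ℝ} {Φ : ℝ → ℝ → Plane}
    {t x y : ℝ} (hx : t < x) (hy : t < y) (hxy : x ≠ y)
    (hΦ : ∀ x > t, HasDerivAt (fun s => Φ s x)
      (toEuclideanLin (-((x - t)⁻¹ • W θ z u t 2)) (Φ t x)) t) :
    HasDerivAt (fun s => kernel (Φ s) x y)
      (∑ i, (toEuclideanLin (J * W θ z u t 2) (Φ t x) i / (x - t)) * (Φ t y i / (y - t))) t := by
  have h1 := (((matrixCLM J).hasFDerivAt.comp_hasDerivAt t (hΦ x hx)).inner ℝ (hΦ y hy)).div_const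
    (x - y)
  refine h1.congr_deriv ?_
  have h2 : ∑ i, (toEuclideanLin (J * W θ z u t 2) (Φ t x) i / (x - t)) * (Φ t y i / (y - t)) =
      ⟪toEuclideanLin (J * W θ z u t 2) (Φ t x), Φ t y⟫_ℝ / ((x - t) * (y - t)) := by
    simp only [PiLp.inner_apply, Finset.sum_div]
    refine Finset.sum_congr rfl fun i _ => ?_
    simp only [inner, star_trivial]
    rw [div_mul_div_comm, mul_comm (Φ t y i)]
    rfl
  rw [h2]
  have h3 : ∀ v : Plane, matrixCLM J (toEuclideanLin (W θ z u t 2) v) =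
      toEuclideanLin (J * W θ z u t 2) v := fun v => by
    simp [matrixCLM_apply, toLpLin_mul_same]
  have h4 := inner_J_residue (z 2 t) (θ 2) (u 2 t) (Φ t x) (Φ t y)
  simp only [map_neg, map_smul, LinearMap.neg_apply, LinearMap.smul_apply, Function.comp_apply,
    inner_neg_left, inner_neg_right, inner_smul_left, inner_smul_right, h3, matrixCLM_apply,
    conj_trivial]
  rw [W, h4]
  have hx' := (sub_pos.2 hx).ne'
  have hy' := (sub_pos.2 hy).ne'
  have hxy' := sub_ne_zero.2 hxy
  field_simp
  ring

end PainleveSix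

end

theorem theorem3p3
    (I : Set ℝ) (hI : IsOpen I) (hI1 : ∀ t ∈ I, 1 < t)
    (θ : Fin 3 → ℝ) (θinf : ℂ) (z u : Fin 3 → ℝ → ℝ)
    (hu : ∀ t ∈ I, ∀ ν, u ν t ≠ 0)
    -- the eigenvalues of `W_∞` are `∓ θ_∞ / 2`
    (hWinf : ∀ t ∈ I, ((PainleveSix.WInf θ z u t).map Complex.ofReal).charpoly =
      (Polynomial.X + Polynomial.C (θinf / 2)) * (Polynomial.X - Polynomial.C (θinf / 2)))
    (hθinf : ∀ n : ℕ, 0 < n → θinf ≠ n ∧ -θinf ≠ n)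
    -- `Φ t x` is a bounded solution on `x > t`, square integrable for `dx / x`
    (Φ : ℝ → ℝ → PainleveSix.Plane)
    (hode : ∀ t ∈ I, ∀ x > t, HasDerivAt (Φ t)
      (Matrix.toEuclideanLin (PainleveSix.coeff θ z u t x) (Φ t x)) x)
    (hbdd : ∀ t ∈ I, ∃ M : ℝ, ∀ x > t, ‖Φ t x‖ ≤ M)
    (hint : ∀ t ∈ I, IntegrableOn (fun x => x⁻¹ * ‖Φ t x‖ ^ 2) (Ioi t)) :
    -- (i)
    (∀ t ∈ I, ∃ (V : Fin 3 → Matrix (Fin 1 ⊕ Fin 1) (Fin 2) ℝ) (φ : ℝ → PainleveSix.Six ℝ),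
      (∀ ν, PainleveSix.J * PainleveSix.W θ z u t ν =
        (V ν)ᵀ * PainleveSix.sig ℝ 1 1 * V ν) ∧
      (∀ x > t, φ x = PainleveSix.symbol t V (Φ t) x) ∧
      MemLp (fun x => φ (t + x)) 2 PainleveSix.weightedHalfLine ∧
      (∀ x > t, ∀ y > t, x ≠ y →
        IntegrableOn (fun s =>
          ⟪Matrix.toEuclideanLin (PainleveSix.sig ℝ 3 3) (φ (x + s)), φ (y + s)⟫_ℝ) (Ioi 0) ∧
        PainleveSix.kernel (Φ t) x y = ∫ s in Ioi (0 : ℝ),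
          ⟪Matrix.toEuclideanLin (PainleveSix.sig ℝ 3 3) (φ (x + s)), φ (y + s)⟫_ℝ) ∧
      ∃ (K : PainleveSix.L2 t ℂ →L[ℂ] PainleveSix.L2 t ℂ)
        (Γ : PainleveSix.L2 t ℂ →L[ℂ] PainleveSix.L2 0 (PainleveSix.Six ℂ)),
        PainleveSix.IsIntegralOperator K (fun x y => (PainleveSix.kernel (Φ t) x y : ℂ)) ∧
        PainleveSix.IsIntegralOperator Γ (fun s x => PainleveSix.complexify (φ (s + x))) ∧
        K = ContinuousLinearMap.adjoint Γ ∘L PainleveSix.sigOp 0 ∘L Γ ∧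
        PainleveSix.IsTraceClass K) ∧
    -- (ii), for solutions which also satisfy the deformation equation in `t`
    ((∀ t ∈ I, ∀ x > t, HasDerivAt (fun s => Φ s x)
        (Matrix.toEuclideanLin (-((x - t)⁻¹ • PainleveSix.W θ z u t 2)) (Φ t x)) t) →
      ∀ t ∈ I, ∃ k : ℝ → ℝ → ℝ,
        (∀ x > t, ∀ y > t, x ≠ y →
          HasDerivAt (fun s => PainleveSix.kernel (Φ s) x y) (k x y) t) ∧
        PainleveSix.IsFiniteRankKernel t k) := by
  refine ⟨fun t ht => ?_, fun hdef t ht => ?_⟩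
  · obtain ⟨M, hM⟩ := hbdd t ht
    have ht1 := hI1 t ht
    choose V hV hVC using fun ν =>
      PainleveSix.exists_signature_factorization (z ν t) (θ ν) (u ν t) (hu t ht ν)
    have hw := PainleveSix.integrableOn_weight_mul_norm_symbol_sq ht1 (hu t ht 2) (hode t ht) hM
      (hint t ht) (hVC 2)
    have hφ : ContinuousOn (PainleveSix.symbol t V (Φ t)) (Ioi t) :=
      PainleveSix.continuousOn_symbol ht1 fun x hx =>
        (hode t ht x hx).continuousAt.continuousWithinAt
    exact ⟨V, PainleveSix.symbol t V (Φ t), hV, fun _ _ => rfl,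
      PainleveSix.memLp_two_weightedHalfLine hφ hw,
      fun x hx y hy hxy =>
        PainleveSix.kernel_eq_integral ht1 (hode t ht) hM hV hw hx hy hxy,
      PainleveSix.exists_hankel_factorization ht1 (hode t ht) hM hV hw⟩
  · have hΦ : ContinuousOn (Φ t) (Ioi t) := fun x hx =>
      (hode t ht x hx).continuousAt.continuousWithinAt
    have hne : ∀ x ∈ Ioi t, x - t ≠ 0 := fun x hx => (sub_pos.2 hx).ne'
    refine ⟨_, fun x hx y hy hxy =>
      PainleveSix.hasDerivAt_kernel_param hx hy hxy (hdef t ht), 2, _, _, fun i => ?_, fun i => ?_,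
      fun x _ y _ _ => rfl⟩
    · have h1 : Continuous fun v : PainleveSix.Plane =>
          Matrix.toEuclideanLin (PainleveSix.J * PainleveSix.W θ z u t 2) v i :=
        (EuclideanSpace.proj (𝕜 := ℝ) i).continuous.comp (PainleveSix.matrixCLM _).continuous
      exact (h1.comp_continuousOn hΦ).div (by fun_prop) hne
    · have h1 : Continuous fun v : PainleveSix.Plane => v i :=
        (EuclideanSpace.proj (𝕜 := ℝ) i).continuous
      exact (h1.comp_continuousOn hΦ).div (by fun_prop) hne
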